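/- Let $G^s=(V^s,E^s)$ be a finite directed graph (a social network) in which each link $(u,v)\in E^s$ has a propagation probability $p(u,v)\in[0,1]$ and each node $v\in V^s$ has a criticality value $cr_v\ge 0$, with $\Omega=\sum_{v\in V^s}cr_v>0$. Let $n=|V^s|$, let $1\le k\le n$, $\epsilon>0$, $0<\delta<1$, and put $$\tau=\sqrt{\ln\tfrac2\delta},\qquad \sigma=\sqrt{\left(1-\tfrac1e\right)\left(\ln\tbinom nk+\ln\tfrac2\delta\right)},\qquad \phi=\frac{(1-1/e)\,\sigma+\tau}{\epsilon},\qquad \gamma=2\left(\phi^2+\ln\tfrac2\delta\right).$$ A random RR (reverse reachable) set is generated as follows: draw an origin node, the node $v$ with probability $cr_v/\Omega$; starting from the origin, search backwards along the links, where each link $(u,v)$ into a node $v$ that has been found is examined once and is live with probability $p(u,v)$, independently of everything else; the RR set consists of the nodes found, that is, those that reach the origin along live links. For a collection $\mathcal R$ of RR sets and a set $S$ of nodes, $\deg_{\mathcal R}(S)$ is the number of members of $\mathcal R$ that contain a node of $S$. The algorithm Targeted-IM starts with $\mathcal R=\emptyset$, $\bar S=\emptyset$, $N_R^0=1$, $N_R=\gamma$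 and, while $\deg_{\mathcal R}(\bar S)<\gamma$, repeats: for $i=N_R^0,N_R^0+1,\dots$ up to $N_R$, generate a new independent RR set and add it to $\mathcal R$ (counted with multiplicity); let $\bar S$ be the result of greedy maximum coverage on $\mathcal R$ (up to $k$ times, choose a node that lies in the greatest positive number of members of $\mathcal R$ not yet covered; implemented with incidence lists and degree buckets); set $N_R^0=N_R$ and then $N_R=2N_R$. Finally it returns $\bar S$. The running time is the number of elementary operations of a unit-cost random access machine, where the drawing of an origin and the flip of a coin cost one operation each, plus $n$ operations for the initialization; the graph is given by in-adjacency lists. Then, for networks with $|V^s|=O(|E^s|)$, the expected running time of Targeted-IM is $O(\gamma|E^s|)$: for every real $a$ there is a constant $C$, depending on $a$ only, such that for all such $G^s,p,cr,k,\epsilon,\delta$ with $|V^s|\le a|E^s|$ the expected running time is at most $C\,\gamma\,|E^s|$. -/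

import Mathlib

open MeasureTheory ProbabilityTheory
open scoped ENNReal NNReal

namespace TargetedIM

/-! ### Step-counted computations (unit-cost random access machine) -/

/-- A result together with the number of elementary operations spent on computing it.  One
elementary operation stands for a bounded amount of work of a random access machine: moving one
step along a list, a bounded number of reads and writes of array cells, a bounded number of
arithmetic operations and comparisons, the drawing of one origin node, or the flip of one coin.
Arrays are written as functions on their index set, `Function.update` being the write to a cell. -/
structure Timed (α : Type) where
  val : α
  cost : ℕ

instance : Monad Timed where
  pure a := ⟨a, 0⟩
  bind x f := ⟨(f x.val).val, x.cost + (f x.val).cost⟩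

/-- Spend `c` elementary operations. -/
def tick (c : ℕ) : Timed Unit := ⟨(), c⟩

/-! ### The social network and its random draws -/

/-- A social network on the users `0, …, n - 1`: directed links `(u, v)`, a propagation probability
of each link (the values of `prob` off the links are never used), and nonnegative criticality values
of the users, not all of them zero. -/
structure SocialNetwork (n : ℕ) where
  links : Finset (Fin n × Fin n)
  prob : Fin n → Fin n → unitInterval
  cr : Fin n → ℝ≥0
  exists_critical : ∃ v, cr v ≠ 0

/-- The list of the in-neighbours of `v`; the network is given to the algorithm by these
adjacency lists. -/
def SocialNetwork.inList {n : ℕ} (G : SocialNetwork n) (v : Fin n) : List (Fin n) :=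
  (List.finRange n).filter fun u => (u, v) ∈ G.links

/-- The total criticality `Ω`. -/
noncomputable def SocialNetwork.totalCr {n : ℕ} (G : SocialNetwork n) : ℝ≥0 := ∑ v, G.cr v

lemma SocialNetwork.sum_cr_div {n : ℕ} (G : SocialNetwork n) :
    ∑ v, ((G.cr v / G.totalCr : ℝ≥0) : ℝ≥0∞) = 1 := by
  have h : G.totalCr ≠ 0 := by
    obtain ⟨v, hv⟩ := G.exists_critical
    intro h0
    exact hv (Finset.sum_eq_zero_iff.mp h0 v (Finset.mem_univ v))
  rw [← ENNReal.ofNNReal_finsetSum, ← Finset.sum_div]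
  change (((G.totalCr / G.totalCr : ℝ≥0)) : ℝ≥0∞) = 1
  rw [div_self h, ENNReal.coe_one]

/-- The law of the origin of a random RR set: the user `v` with probability `cr v / Ω`. -/
noncomputable def SocialNetwork.originLaw {n : ℕ} (G : SocialNetwork n) : PMF (Fin n) :=
  PMF.ofFintype (fun v => ((G.cr v / G.totalCr : ℝ≥0) : ℝ≥0∞)) G.sum_cr_div

/-- The randomness available to the generation of one RR set: an origin, and for each pair `(u, v)`
the coin that decides whether the link `(u, v)` is live in the sample graph. -/
abbrev Draw (n : ℕ) : Type := Fin n × (Fin n → Fin n → Bool)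

/-- The law of a draw: the origin follows `originLaw`, the coin of `(u, v)` shows `true` with
probability `prob u v`, and all of these are independent. -/
noncomputable def SocialNetwork.drawLaw {n : ℕ} (G : SocialNetwork n) : Measure (Draw n) :=
  G.originLaw.toMeasure.prod
    (Measure.pi fun u => Measure.pi fun v => bernoulliMeasure true false (G.prob u v))

instance {n : ℕ} (G : SocialNetwork n) : IsProbabilityMeasure G.drawLaw := by
  unfold SocialNetwork.drawLaw
  infer_instance

/-- The law of the random tape of the algorithm: the `i`-th entry is read when the `i`-th RR set is
generated, and the entries are independent draws. -/
noncomputable def SocialNetwork.tapeLaw {n : ℕ} (G : SocialNetwork n) : Measure (ℕ → Draw n) :=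
  Measure.infinitePi fun _ => G.drawLaw

/-! ### Generation of one RR set by reverse search from a random origin -/

/-- State of the reverse search: marks of the nodes found so far, found nodes whose in-links have
not been examined yet, and the list of all found nodes. -/
structure Search (n : ℕ) where
  mark : Fin n → Bool
  todo : List (Fin n)
  found : List (Fin n)

/-- Examine the links into `v` from the listed nodes. -/
def scanLinks {n : ℕ} (live : Fin n → Fin n → Bool) (v : Fin n) :
    List (Fin n) → Search n → Timed (Search n)
  | [], s => pure s
  | u :: us, s => do
      tick 1
      if live u v = true ∧ s.mark u = false then
        tick 1
        scanLinks live v us ⟨Function.update s.mark u true, u :: s.todo, u :: s.found⟩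
      else
        scanLinks live v us s

/-- Repeat: take a found node off `todo` and examine its in-links.  The first argument bounds the
number of repetitions; every node is taken at most once, so that the bound `n` is never the reason
to stop. -/
def explore {n : ℕ} (G : SocialNetwork n) (live : Fin n → Fin n → Bool) :
    ℕ → Search n → Timed (Search n)
  | 0, s => pure s
  | f + 1, s =>
      match s.todo with
      | [] => pure s
      | v :: vs => do
          tick 1
          let s' ← scanLinks live v (G.inList v) ⟨s.mark, vs, s.found⟩
          explore G live f s'

/-- Generate one RR set: the list of the nodes that reach the origin along live links.  One operation
is spent on the draw of the origin; at the end, the marks are erased. -/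
def generateRR {n : ℕ} (G : SocialNetwork n) (d : Draw n) : Timed (List (Fin n)) := do
  tick 1
  let s ← explore G d.2 n ⟨Function.update (fun _ => false) d.1 true, [d.1], [d.1]⟩
  tick s.found.length
  pure s.found

/-! ### Greedy maximum coverage -/

/-- For each node the number of RR sets that contain it and the list of (number of, pointer to)
these RR sets, and the list of the nodes that occur in some RR set. -/
structure Incidence (n : ℕ) where
  deg : Fin n → ℕ
  sets : Fin n → List (ℕ × List (Fin n))
  touched : List (Fin n)

/-- Enter the RR set `R`, which has number `i`, at the listed nodes. -/
def indexSet {n : ℕ} (i : ℕ) (R : List (Fin n)) :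
    List (Fin n) → Incidence n → Timed (Incidence n)
  | [], x => pure x
  | v :: vs, x => do
      tick 1
      indexSet i R vs
        ⟨Function.update x.deg v (x.deg v + 1), Function.update x.sets v ((i, R) :: x.sets v),
          if x.deg v = 0 then v :: x.touched else x.touched⟩

/-- Enter all listed RR sets, numbered from `i` on. -/
def indexAll {n : ℕ} : ℕ → List (List (Fin n)) → Incidence n → Timed (Incidence n)
  | _, [], x => pure x
  | i, R :: Rs, x => do
      tick 1
      let x' ← indexSet i R R x
      indexAll (i + 1) Rs x'

/-- Put each listed node `v` into the bucket number `deg v`. -/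
def fillBuckets {n : ℕ} (deg : Fin n → ℕ) :
    List (Fin n) → (ℕ → List (Fin n)) → Timed (ℕ → List (Fin n))
  | [], b => pure b
  | v :: vs, b => do
      tick 1
      fillBuckets deg vs (Function.update b (deg v) (v :: b (deg v)))

/-- State of the greedy selection: `deg v` is the number of RR sets not yet covered that contain `v`;
`covered` flags the covered RR sets, by their numbers; `bucket` sorts the nodes by their degrees at
the time of insertion; `left` more nodes may be chosen; `seeds` are the chosen nodes; and
`gain` is the number of covered RR sets. -/
structure Greedy (n : ℕ) where
  deg : Fin n → ℕ
  covered : ℕ → Bool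
  bucket : ℕ → List (Fin n)
  left : ℕ
  seeds : List (Fin n)
  gain : ℕ

/-- Decrease the degrees of the listed nodes by one. -/
def lowerDegrees {n : ℕ} : List (Fin n) → (Fin n → ℕ) → Timed (Fin n → ℕ)
  | [], deg => pure deg
  | u :: us, deg => do
      tick 1
      lowerDegrees us (Function.update deg u (deg u - 1))

/-- Cover those of the listed RR sets that are not yet covered. -/
def coverSets {n : ℕ} : List (ℕ × List (Fin n)) → Greedy n → Timed (Greedy n)
  | [], s => pure s
  | (i, R) :: rest, s => do
      tick 1
      if s.covered i = true then
        coverSets rest s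
      else
        let deg' ← lowerDegrees R s.deg
        coverSets rest
          ⟨deg', Function.update s.covered i true, s.bucket, s.left, s.seeds, s.gain + 1⟩

/-- Go through the listed nodes, which form the bucket number `d`: a node that still has degree `d`
is chosen, any other node is moved to the bucket of its present degree. -/
def serveBucket {n : ℕ} (sets : Fin n → List (ℕ × List (Fin n))) (d : ℕ) :
    List (Fin n) → Greedy n → Timed (Greedy n)
  | [], s => pure s
  | v :: vs, s => do
      tick 1
      if s.left = 0 then
        pure s
      else if s.deg v = d then
        let s' ← coverSets (sets v)
          ⟨s.deg, s.covered, s.bucket, s.left - 1, v :: s.seeds, s.gain⟩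
        serveBucket sets d vs s'
      else
        serveBucket sets d vs
          ⟨s.deg, s.covered, Function.update s.bucket (s.deg v) (v :: s.bucket (s.deg v)),
            s.left, s.seeds, s.gain⟩

/-- Serve the buckets number `d, d - 1, …, 1`, in this order. -/
def serveBuckets {n : ℕ} (sets : Fin n → List (ℕ × List (Fin n))) :
    ℕ → Greedy n → Timed (Greedy n)
  | 0, s => pure s
  | d + 1, s => do
      tick 1
      let s' ← serveBucket sets (d + 1) (s.bucket (d + 1)) s
      serveBuckets sets d s'

/-- Greedy maximum coverage: up to `k` times, choose a node that lies in the greatest (positive)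
number of RR sets not yet covered.  Returns the chosen nodes and the number of RR sets that they
cover.  At the end, the used cells of the arrays are erased. -/
def greedyMC {n : ℕ} (k : ℕ) (RR : List (List (Fin n))) : Timed (List (Fin n) × ℕ) := do
  tick 1
  let x ← indexAll 0 RR ⟨fun _ => 0, fun _ => [], []⟩
  let b ← fillBuckets x.deg x.touched (fun _ => [])
  let s ← serveBuckets x.sets RR.length ⟨x.deg, fun _ => false, b, k, [], 0⟩
  tick (RR.length + x.touched.length)
  pure (s.seeds, s.gain)

/-! ### The algorithm Targeted-IM -/

/-- State of the main loop: the collection of the RR sets, the check points `N_R⁰` and `N_R`, the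
present seed set, and the number of RR sets that it covers. -/
structure Main (n : ℕ) where
  RR : List (List (Fin n))
  lo : ℝ
  hi : ℝ
  seeds : List (Fin n)
  deg : ℕ

/-- Generate `c` further RR sets and add them to the collection. -/
def generateMany {n : ℕ} (G : SocialNetwork n) (tape : ℕ → Draw n) :
    ℕ → List (List (Fin n)) → Timed (List (List (Fin n)))
  | 0, RR => pure RR
  | c + 1, RR => do
      tick 1
      let R ← generateRR G (tape RR.length)
      generateMany G tape c (R :: RR)

/-- The body of the main loop.  The loop `for i = lo to hi`, with the values
`lo, lo + 1, lo + 2, … ≤ hi` of `i`, is run `⌊hi - lo⌋ + 1` times. -/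
noncomputable def mainBody {n : ℕ} (G : SocialNetwork n) (k : ℕ) (tape : ℕ → Draw n)
    (s : Main n) : Timed (Main n) := do
  let RR ← generateMany G tape (⌊s.hi - s.lo⌋₊ + 1) s.RR
  let out ← greedyMC k RR
  tick 1
  pure ⟨RR, s.hi, 2 * s.hi, out.1, out.2⟩

open Classical in
/-- The main loop `while deg < γ`, cut off after the given number of rounds. -/
noncomputable def mainLoop {n : ℕ} (G : SocialNetwork n) (k : ℕ) (γ : ℝ) (tape : ℕ → Draw n) :
    ℕ → Main n → Timed (Main n)
  | 0, s => pure s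
  | f + 1, s => do
      tick 1
      if (s.deg : ℝ) < γ then
        let s' ← mainBody G k tape s
        mainLoop G k γ tape f s'
      else
        pure s

/-- The algorithm, cut off after the given number of rounds of the main loop.  The first `n`
operations read the criticality values, prepare the drawing of origins and initialize the
arrays. -/
noncomputable def targetedIM {n : ℕ} (G : SocialNetwork n) (k : ℕ) (γ : ℝ) (tape : ℕ → Draw n)
    (rounds : ℕ) : Timed (Main n) := do
  tick n
  mainLoop G k γ tape rounds ⟨[], 1, γ, [], 0⟩

/-- The running time on a given tape: the number of operations of the run that is not cut off
(infinite if the main loop does not end). -/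
noncomputable def runningTime {n : ℕ} (G : SocialNetwork n) (k : ℕ) (γ : ℝ)
    (tape : ℕ → Draw n) : ℝ≥0∞ :=
  ⨆ rounds : ℕ, ((targetedIM G k γ tape rounds).cost : ℝ≥0∞)

/-- The expected running time. -/
noncomputable def expectedRunningTime {n : ℕ} (G : SocialNetwork n) (k : ℕ) (γ : ℝ) : ℝ≥0∞ :=
  ∫⁻ tape, runningTime G k γ tape ∂G.tapeLaw

/-! ### The stopping threshold -/

noncomputable def tau (δ : ℝ) : ℝ := √(Real.log (2 / δ))

noncomputable def sigma (n k : ℕ) (δ : ℝ) : ℝ :=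
  √((1 - 1 / Real.exp 1) * (Real.log (n.choose k) + Real.log (2 / δ)))

noncomputable def phi (n k : ℕ) (ε δ : ℝ) : ℝ :=
  ((1 - 1 / Real.exp 1) * sigma n k δ + tau δ) / ε

/-- The stopping threshold `γ = 2 (φ² + log (2 / δ))`. -/
noncomputable def threshold (n k : ℕ) (ε δ : ℝ) : ℝ :=
  2 * (phi n k ε δ ^ 2 + Real.log (2 / δ))

end TargetedIM

/-!
Charge to each RR set its workload, the number of its members plus the number of links into them.
Up to a constant factor, a round of the main loop costs the total workload of all RR sets generated
so far. Let `v` be a node that maximizes the probability `p` of lying in a random RR set. The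
expected workload is `∑ u, P(u ∈ RR) (1 + indeg u) ≤ p (n + m)`, where `m` is the number of links.
Greedy maximum coverage covers at least as many RR sets as `v` alone does, so a further round is
needed only if fewer than `γ` of the present `N` RR sets contain `v`. By a Chernoff bound the
probability of this is exponentially small in `N p` once `N p` is large compared with `γ`. Since `N`
is roughly `2 ^ r γ` after `r` rounds, the expected costs `N p (n + m)` of the rounds, weighted by
these probabilities, add up to `O(γ (n + m))`, whatever `p` is.
-/

namespace TargetedIM

/-! ### Counting hits in a sequence of independent draws -/

section Sampling

variable {ι X : Type*}

open Classical in
/-- The number of the places in `s` at which the sequence `ω` takes a value in `A`. -/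
noncomputable def hitCount (A : Set X) (s : Finset ι) (ω : ι → X) : ℕ :=
  (s.filter fun i => ω i ∈ A).card

lemma hitCount_mono (A : Set X) {s t : Finset ι} (h : s ⊆ t) (ω : ι → X) :
    hitCount A s ω ≤ hitCount A t ω := by
  classical exact Finset.card_le_card (Finset.filter_subset_filter _ h)

lemma hitCount_eq_sum_indicator (A : Set X) (s : Finset ι) (ω : ι → X) :
    (hitCount A s ω : ℝ) = ∑ i ∈ s, A.indicator 1 (ω i) := by
  classical
  simp only [hitCount, Set.indicator_apply, Pi.one_apply, Finset.sum_boole]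

lemma hitCount_univ_restrict (A : Set X) (s : Finset ι) (ω : ι → X) :
    hitCount A Finset.univ (s.restrict ω) = hitCount A s ω := by
  have h : (hitCount A Finset.univ (s.restrict ω) : ℝ) = hitCount A s ω := by
    rw [hitCount_eq_sum_indicator, hitCount_eq_sum_indicator]
    exact Finset.sum_coe_sort s fun i => A.indicator (1 : X → ℝ) (ω i)
  exact_mod_cast h

variable [MeasurableSpace X] {A : Set X}

lemma measurable_hitCount (hA : MeasurableSet A) (s : Finset ι) :
    Measurable fun ω : ι → X => (hitCount A s ω : ℝ) := by
  simp_rw [hitCount_eq_sum_indicator]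
  exact Finset.measurable_fun_sum _ fun i _ =>
    (measurable_one.indicator hA).comp (measurable_pi_apply i)

variable (μ : Measure X) [IsProbabilityMeasure μ]

lemma mgf_indicator_neg_one_le (hA : MeasurableSet A) :
    mgf (A.indicator 1) μ (-1) ≤ Real.exp (-(μ.real A / 2)) := by
  have hexp : ∀ x, Real.exp (-1 * A.indicator 1 x) =
      1 - A.indicator (fun _ => 1 - Real.exp (-1)) x := by
    intro x
    by_cases hx : x ∈ A <;> simp [hx]
  have hmgf : mgf (A.indicator 1) μ (-1) = 1 - μ.real A * (1 - Real.exp (-1)) := by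
    simp_rw [mgf, hexp]
    rw [integral_sub (integrable_const _) ((integrable_const _).indicator hA),
      integral_indicator_const _ hA]
    simp
  have hhalf : 1 / 2 ≤ 1 - Real.exp (-1) := by
    have := Real.exp_neg_one_lt_half
    linarith
  have hμA : 0 ≤ μ.real A := measureReal_nonneg
  calc mgf (A.indicator 1) μ (-1) = 1 - μ.real A * (1 - Real.exp (-1)) := hmgf
    _ ≤ -(μ.real A / 2) + 1 := by nlinarith
    _ ≤ Real.exp (-(μ.real A / 2)) := Real.add_one_le_exp _

lemma measure_hitCount_le_le (hA : MeasurableSet A) (s : Finset ι) (c : ℝ) :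
    (Measure.infinitePi fun _ : ι => μ).real {ω | (hitCount A s ω : ℝ) ≤ c} ≤
      Real.exp (c - μ.real A * s.card / 2) := by
  set P := Measure.infinitePi fun _ : ι => μ
  have hf : Measurable (A.indicator (1 : X → ℝ)) := measurable_one.indicator hA
  have hmgf : mgf (fun ω => (hitCount A s ω : ℝ)) P (-1) = mgf (A.indicator 1) μ (-1) ^ s.card := by
    have heval (i : ι) : mgf (fun ω : ι → X => A.indicator 1 (ω i)) P (-1) =
        mgf (A.indicator 1) μ (-1) := by
      have hi := measurePreserving_eval_infinitePi (fun _ : ι => μ) i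
      rw [← hi.map_eq, mgf_map hi.aemeasurable (by fun_prop)]
      rfl
    simp_rw [hitCount_eq_sum_indicator]
    rw [← Finset.sum_fn,
      (iIndepFun_infinitePi fun _ => hf).mgf_sum (fun i => hf.comp (measurable_pi_apply i)),
      Finset.prod_congr rfl fun i _ => heval i, Finset.prod_const]
  have hint : Integrable (fun ω => Real.exp (-1 * (hitCount A s ω : ℝ))) P :=
    .of_bound ((measurable_hitCount hA s).const_mul _).exp.aestronglyMeasurable 1
      (.of_forall fun ω => by simp)
  calc P.real {ω | (hitCount A s ω : ℝ) ≤ c}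
      ≤ Real.exp (-(-1) * c) * mgf (A.indicator 1) μ (-1) ^ s.card := by
        rw [← hmgf]
        exact measure_le_le_exp_mul_mgf c (by norm_num) hint
    _ ≤ Real.exp (-(-1) * c) * Real.exp (-(μ.real A / 2)) ^ s.card := by
        gcongr
        · exact mgf_nonneg
        · exact mgf_indicator_neg_one_le μ hA
    _ = Real.exp (c - μ.real A * s.card / 2) := by
        rw [← Real.exp_nat_mul, ← Real.exp_add]
        congr 1
        ring

lemma setLIntegral_hitCount_le_of_notMem (hA : MeasurableSet A) {s : Finset ι} {i : ι}
    (hi : i ∉ s) (c : ℝ) {w : X → ℝ≥0∞} (hw : Measurable w) :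
    ∫⁻ ω in {ω | (hitCount A s ω : ℝ) ≤ c}, w (ω i) ∂(Measure.infinitePi fun _ => μ) =
      (Measure.infinitePi fun _ => μ) {ω | (hitCount A s ω : ℝ) ≤ c} * ∫⁻ x, w x ∂μ := by
  classical
  set P := Measure.infinitePi fun _ : ι => μ
  set B := {y : s → X | (hitCount A Finset.univ y : ℝ) ≤ c}
  have hB : MeasurableSet B := measurableSet_le (measurable_hitCount hA _) measurable_const
  have hpre : {ω : ι → X | (hitCount A s ω : ℝ) ≤ c} = s.restrict ⁻¹' B := by
    ext ω
    simp only [B, Set.mem_ofPred_eq, Set.mem_preimage, hitCount_univ_restrict]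
  have hrestrict : Measurable (s.restrict : (ι → X) → s → X) := Finset.measurable_restrict s
  have hwi : Measurable fun ω : ι → X => w (ω i) := by fun_prop
  have heval : iIndepFun (fun (j : ι) (ω : ι → X) => ω j) P :=
    iIndepFun_infinitePi fun _ => measurable_id
  have hindep : IndepFun (B.indicator (1 : (s → X) → ℝ≥0∞) ∘ s.restrict) (fun ω => w (ω i)) P :=
    (heval.indepFun_finset s {i} (by simpa using hi) measurable_pi_apply).comp
      (measurable_one.indicator hB)
        (ψ := fun y => w (y ⟨i, Finset.mem_singleton_self i⟩)) (by fun_prop)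
  calc ∫⁻ ω in {ω | (hitCount A s ω : ℝ) ≤ c}, w (ω i) ∂P
      = ∫⁻ ω, (B.indicator 1 ∘ s.restrict) ω * w (ω i) ∂P := by
        rw [hpre, ← lintegral_indicator (hrestrict hB)]
        simp only [Set.indicator_apply, Set.mem_preimage, Function.comp_apply, Pi.one_apply,
          ite_mul, one_mul, zero_mul]
    _ = P {ω | (hitCount A s ω : ℝ) ≤ c} * ∫⁻ x, w x ∂μ := by
        rw [lintegral_mul_eq_lintegral_mul_lintegral_of_indepFun''
            ((measurable_one.indicator hB).comp hrestrict).aemeasurable hwi.aemeasurable hindep,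
          (measurePreserving_eval_infinitePi (fun _ : ι => μ) i).lintegral_comp hw, hpre,
          ← lintegral_indicator_one (hrestrict hB)]
        rfl

-- Ignoring the place `i` in the count makes the condition independent of `ω i`.
lemma setLIntegral_hitCount_lt_le (hA : MeasurableSet A) (s : Finset ι) (i : ι) (c : ℝ)
    {w : X → ℝ≥0∞} (hw : Measurable w) :
    ∫⁻ ω in {ω | (hitCount A s ω : ℝ) < c}, w (ω i) ∂(Measure.infinitePi fun _ => μ) ≤
      ENNReal.ofReal (min 1 (Real.exp (c + 1 / 2 - μ.real A * s.card / 2))) * ∫⁻ x, w x ∂μ := by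
  classical
  set P := Measure.infinitePi fun _ : ι => μ
  have hsub : {ω : ι → X | (hitCount A s ω : ℝ) < c} ⊆ {ω | (hitCount A (s.erase i) ω : ℝ) ≤ c} :=
    fun ω (hω : _ < c) => (Nat.cast_le.2 (hitCount_mono A (s.erase_subset i) ω)).trans hω.le
  have hprob : P {ω | (hitCount A (s.erase i) ω : ℝ) ≤ c} ≤
      ENNReal.ofReal (min 1 (Real.exp (c + 1 / 2 - μ.real A * s.card / 2))) := by
    rw [← ofReal_measureReal]
    refine ENNReal.ofReal_le_ofReal (le_min measureReal_le_one
      ((measure_hitCount_le_le μ hA _ c).trans (Real.exp_le_exp.2 ?_)))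
    have hcard : (s.card : ℝ) ≤ (s.erase i).card + 1 := by
      exact_mod_cast Nat.sub_le_iff_le_add.1 Finset.pred_card_le_card_erase
    have hμA : 0 ≤ μ.real A := measureReal_nonneg
    have hμA' : μ.real A ≤ 1 := measureReal_le_one
    nlinarith
  calc ∫⁻ ω in {ω | (hitCount A s ω : ℝ) < c}, w (ω i) ∂P
      ≤ ∫⁻ ω in {ω | (hitCount A (s.erase i) ω : ℝ) ≤ c}, w (ω i) ∂P := lintegral_mono_set hsub
    _ = P {ω | (hitCount A (s.erase i) ω : ℝ) ≤ c} * ∫⁻ x, w x ∂μ :=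
        setLIntegral_hitCount_le_of_notMem μ hA (s.notMem_erase i) c hw
    _ ≤ _ := by gcongr

lemma min_one_exp_le {γ x : ℝ} (hγ : 1 ≤ γ) :
    min 1 (Real.exp (γ + 1 / 2 - x * γ / 4)) ≤ Real.exp (3 / 2 - x / 4) := by
  rcases le_total x 4 with hx | hx
  · exact (min_le_left _ _).trans (Real.one_le_exp (by linarith))
  · exact (min_le_right _ _).trans (Real.exp_le_exp.2 (by nlinarith))

-- The bound by a difference makes the sum over `x = p, 2 p, 4 p, …` telescope.
lemma mul_exp_neg_le (x : ℝ) :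
    x * Real.exp (-(x / 4)) ≤ 8 * (Real.exp (-(x / 8)) - Real.exp (-(2 * x / 8))) := by
  have hsplit : Real.exp (-(x / 8)) = Real.exp (-(x / 4)) * Real.exp (x / 8) := by
    rw [← Real.exp_add]
    congr 1
    ring
  have hbase : x / 8 + 1 ≤ Real.exp (x / 8) := Real.add_one_le_exp _
  have hpos : 0 < Real.exp (-(x / 4)) := Real.exp_pos _
  rw [hsplit, show 2 * x / 8 = x / 4 by ring]
  nlinarith

lemma tsum_ofReal_sub_succ_le {g : ℕ → ℝ} (hg : Antitone g) (hg0 : ∀ r, 0 ≤ g r) :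
    ∑' r, ENNReal.ofReal (g r - g (r + 1)) ≤ ENNReal.ofReal (g 0) := by
  rw [ENNReal.tsum_eq_iSup_nat]
  refine iSup_le fun R => ?_
  rw [← ENNReal.ofReal_sum_of_nonneg fun r _ => sub_nonneg.2 (hg r.le_succ),
    Finset.sum_range_sub']
  exact ENNReal.ofReal_le_ofReal (sub_le_self _ (hg0 R))

lemma tsum_two_pow_mul_exp_le {p : ℝ} (hp : 0 ≤ p) :
    ∑' r, ENNReal.ofReal (2 ^ r * p * Real.exp (-(2 ^ r * p / 4))) ≤ 8 := by
  set g : ℕ → ℝ := fun r => 8 * Real.exp (-(2 ^ r * p / 8))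
  have hg : Antitone g := antitone_nat_of_succ_le fun r => by
    simp only [g]
    gcongr <;> norm_num
  calc ∑' r, ENNReal.ofReal (2 ^ r * p * Real.exp (-(2 ^ r * p / 4)))
      ≤ ∑' r, ENNReal.ofReal (g r - g (r + 1)) := by
        refine ENNReal.tsum_le_tsum fun r => ENNReal.ofReal_le_ofReal ?_
        simpa only [g, pow_succ', mul_assoc, mul_sub] using mul_exp_neg_le (2 ^ r * p)
    _ ≤ ENNReal.ofReal (g 0) := tsum_ofReal_sub_succ_le hg fun r => by positivity
    _ ≤ ENNReal.ofReal 8 :=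
        ENNReal.ofReal_le_ofReal (mul_le_of_le_one_right (by norm_num) (Real.exp_le_one_iff.2
          (neg_nonpos.2 (by positivity))))
    _ = 8 := by norm_num

lemma setLIntegral_sum_range_le (hA : MeasurableSet A) {w : X → ℝ≥0∞} (hw : Measurable w)
    (M N : ℕ) (c : ℝ) :
    ∫⁻ ω in {ω | (hitCount A (Finset.range M) ω : ℝ) < c}, ∑ i ∈ Finset.range N, w (ω i)
        ∂(Measure.infinitePi fun _ => μ) ≤
      N * (ENNReal.ofReal (min 1 (Real.exp (c + 1 / 2 - μ.real A * M / 2))) * ∫⁻ x, w x ∂μ) := by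
  rw [lintegral_finsetSum _ fun i _ => by fun_prop]
  refine (Finset.sum_le_card_nsmul _ _ _ fun i _ =>
    setLIntegral_hitCount_lt_le μ hA (Finset.range M) i c hw).trans_eq ?_
  simp only [Finset.card_range, nsmul_eq_mul]

variable {w : X → ℝ≥0∞} {W : ℝ≥0∞} {γ : ℝ} {N : ℕ → ℕ}

lemma setLIntegral_doubling_zero_le (hA : MeasurableSet A) (hw : Measurable w)
    (hwW : ∫⁻ x, w x ∂μ ≤ μ A * W) (hhi : N 1 ≤ 2 * γ) :
    ∫⁻ ω in {ω | (hitCount A (Finset.range (N 0)) ω : ℝ) < γ}, ∑ i ∈ Finset.range (N 1), w (ω i)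
        ∂(Measure.infinitePi fun _ => μ) ≤ ENNReal.ofReal (2 * γ) * W := by
  refine (setLIntegral_sum_range_le μ hA hw (N 0) (N 1) γ).trans ?_
  rw [← ENNReal.ofReal_natCast]
  calc _ ≤ ENNReal.ofReal (N 1) * (1 * (1 * W)) := by
        gcongr
        · exact ENNReal.ofReal_le_one.2 (min_le_left _ _)
        · exact hwW.trans (by gcongr; exact prob_le_one)
    _ ≤ ENNReal.ofReal (2 * γ) * W := by
        rw [one_mul, one_mul]
        gcongr

lemma setLIntegral_doubling_succ_le (hA : MeasurableSet A) (hw : Measurable w)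
    (hwW : ∫⁻ x, w x ∂μ ≤ μ A * W) (hγ : 1 ≤ γ) (r : ℕ) (hlo : 2 ^ r * γ / 2 ≤ N (r + 1))
    (hhi : N (r + 2) ≤ 2 * (2 ^ (r + 1) * γ)) :
    ∫⁻ ω in {ω | (hitCount A (Finset.range (N (r + 1))) ω : ℝ) < γ},
        ∑ i ∈ Finset.range (N (r + 2)), w (ω i) ∂(Measure.infinitePi fun _ => μ) ≤
      ENNReal.ofReal (4 * Real.exp (3 / 2) * γ) *
        ENNReal.ofReal (2 ^ r * μ.real A * Real.exp (-(2 ^ r * μ.real A / 4))) * W := by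
  set p := μ.real A with hp
  have hp0 : 0 ≤ p := measureReal_nonneg
  have hexp : min 1 (Real.exp (γ + 1 / 2 - p * N (r + 1) / 2)) ≤
      Real.exp (3 / 2 - 2 ^ r * p / 4) := by
    refine (min_le_min_left 1 (Real.exp_le_exp.2 ?_)).trans (min_one_exp_le hγ)
    nlinarith
  refine (setLIntegral_sum_range_le μ hA hw (N (r + 1)) (N (r + 2)) γ).trans ?_
  rw [← ENNReal.ofReal_natCast]
  calc _ ≤ ENNReal.ofReal (2 * (2 ^ (r + 1) * γ)) *
        (ENNReal.ofReal (Real.exp (3 / 2 - 2 ^ r * p / 4)) * (ENNReal.ofReal p * W)) := by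
        rw [hp, ofReal_measureReal]
        gcongr
    _ = _ := by
        rw [← mul_assoc, ← mul_assoc, ← ENNReal.ofReal_mul (by positivity),
          ← ENNReal.ofReal_mul (by positivity), ← ENNReal.ofReal_mul (by positivity),
          sub_eq_add_neg, Real.exp_add]
        congr 2
        ring

theorem tsum_setLIntegral_doubling_le (hA : MeasurableSet A) (hw : Measurable w)
    (hwW : ∫⁻ x, w x ∂μ ≤ μ A * W) (hγ : 1 ≤ γ) (hlo : ∀ r, 2 ^ r * γ / 2 ≤ N (r + 1))
    (hhi : ∀ r, N (r + 1) ≤ 2 * (2 ^ r * γ)) :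
    ∑' r, ∫⁻ ω in {ω | (hitCount A (Finset.range (N r)) ω : ℝ) < γ},
        ∑ i ∈ Finset.range (N (r + 1)), w (ω i) ∂(Measure.infinitePi fun _ => μ) ≤
      ENNReal.ofReal ((2 + 32 * Real.exp (3 / 2)) * γ) * W := by
  rw [tsum_eq_zero_add' ENNReal.summable]
  calc _ ≤ ENNReal.ofReal (2 * γ) * W +
        ∑' r, ENNReal.ofReal (4 * Real.exp (3 / 2) * γ) *
          ENNReal.ofReal (2 ^ r * μ.real A * Real.exp (-(2 ^ r * μ.real A / 4))) * W :=
        add_le_add (setLIntegral_doubling_zero_le μ hA hw hwW (by simpa using hhi 0))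
          (ENNReal.tsum_le_tsum fun r =>
            setLIntegral_doubling_succ_le μ hA hw hwW hγ r (hlo r) (hhi (r + 1)))
    _ ≤ ENNReal.ofReal (2 * γ) * W + ENNReal.ofReal (4 * Real.exp (3 / 2) * γ) * 8 * W := by
        rw [ENNReal.tsum_mul_right, ENNReal.tsum_mul_left]
        gcongr
        exact tsum_two_pow_mul_exp_le measureReal_nonneg
    _ = ENNReal.ofReal ((2 + 32 * Real.exp (3 / 2)) * γ) * W := by
        rw [← add_mul, show (8 : ℝ≥0∞) = ENNReal.ofReal 8 by norm_num,
          ← ENNReal.ofReal_mul (by positivity), ← ENNReal.ofReal_add (by positivity)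
            (by positivity)]
        congr 2
        ring

end Sampling

/-! ### Cost of the reverse search -/

namespace Timed

variable {α β : Type}

@[simp] lemma val_pure (a : α) : (pure a : Timed α).val = a := rfl

@[simp] lemma cost_pure (a : α) : (pure a : Timed α).cost = 0 := rfl

@[simp] lemma val_bind (x : Timed α) (f : α → Timed β) : (x >>= f).val = (f x.val).val := rfl

lemma bind_congr {x : Timed α} {f g : α → Timed β} (h : f x.val = g x.val) :
    x >>= f = x >>= g := by
  change Timed.mk _ _ = Timed.mk _ _
  rw [h]

@[simp] lemma cost_bind (x : Timed α) (f : α → Timed β) :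
    (x >>= f).cost = x.cost + (f x.val).cost := rfl

end Timed

@[simp] lemma cost_tick (c : ℕ) : (tick c).cost = c := rfl

section Search

variable {n : ℕ}

/-- The found nodes are listed once each, and all of them are marked. -/
def Search.WellFormed (s : Search n) : Prop :=
  s.found.Nodup ∧ ∀ u ∈ s.found, s.mark u = true

lemma Search.WellFormed.scanLinks {s : Search n} (hs : s.WellFormed)
    (live : Fin n → Fin n → Bool) (v : Fin n) (us : List (Fin n)) :
    (scanLinks live v us s).val.WellFormed := by
  induction us generalizing s with
  | nil => exact hs
  | cons u us ih =>
    rw [TargetedIM.scanLinks]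
    split_ifs with h
    · have hu : u ∉ s.found := fun hu => by simp [hs.2 u hu] at h
      refine ih ⟨List.nodup_cons.2 ⟨hu, hs.1⟩, fun x hx => ?_⟩
      rcases List.mem_cons.1 hx with rfl | hx
      · exact Function.update_self ..
      · exact (Function.update_of_ne (ne_of_mem_of_not_mem hx hu) ..).trans (hs.2 x hx)
    · exact ih hs

lemma exists_scanLinks_eq_append (live : Fin n → Fin n → Bool) (v : Fin n) (us : List (Fin n))
    (s : Search n) :
    ∃ new, (scanLinks live v us s).val.todo = new ++ s.todo ∧
      (scanLinks live v us s).val.found = new ++ s.found ∧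
      (scanLinks live v us s).cost = us.length + new.length := by
  induction us generalizing s with
  | nil => exact ⟨[], rfl, rfl, rfl⟩
  | cons u us ih =>
    rw [scanLinks]
    split_ifs with h
    · obtain ⟨new, htodo, hfound, hcost⟩ :=
        ih ⟨Function.update s.mark u true, u :: s.todo, u :: s.found⟩
      refine ⟨new ++ [u], ?_, ?_, ?_⟩
      · simp [htodo]
      · simp [hfound]
      · simp only [Timed.cost_bind, cost_tick, hcost, List.length_append, List.length_cons,
          List.length_nil]
        omega
    · obtain ⟨new, htodo, hfound, hcost⟩ := ih s
      refine ⟨new, htodo, hfound, ?_⟩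
      simp only [Timed.cost_bind, cost_tick, hcost, List.length_cons]
      omega

lemma Search.WellFormed.explore {s : Search n} (hs : s.WellFormed) (G : SocialNetwork n)
    (live : Fin n → Fin n → Bool) (f : ℕ) : (explore G live f s).val.WellFormed := by
  induction f generalizing s with
  | zero => exact hs
  | succ f ih =>
    obtain ⟨mark, todo, found⟩ := s
    cases todo with
    | nil => exact hs
    | cons v vs => exact ih (WellFormed.scanLinks (s := ⟨mark, vs, found⟩) hs live v _)

lemma found_suffix_explore (G : SocialNetwork n) (live : Fin n → Fin n → Bool) (f : ℕ)
    (s : Search n) : s.found <:+ (explore G live f s).val.found := by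
  induction f generalizing s with
  | zero => exact List.suffix_rfl
  | succ f ih =>
    obtain ⟨mark, todo, found⟩ := s
    cases todo with
    | nil => exact List.suffix_rfl
    | cons v vs =>
      obtain ⟨new, -, hfound, -⟩ := exists_scanLinks_eq_append live v (G.inList v) ⟨mark, vs, found⟩
      exact (List.suffix_append new found).trans (hfound ▸ ih _)

/-- The number of the listed nodes and of the links into them. -/
def searchWork (G : SocialNetwork n) (l : List (Fin n)) : ℕ :=
  (l.map fun v => 1 + (G.inList v).length).sum

@[simp] lemma searchWork_cons (G : SocialNetwork n) (v : Fin n) (l : List (Fin n)) :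
    searchWork G (v :: l) = 1 + (G.inList v).length + searchWork G l :=
  List.sum_cons

@[simp] lemma searchWork_append (G : SocialNetwork n) (l l' : List (Fin n)) :
    searchWork G (l ++ l') = searchWork G l + searchWork G l' := by
  simp only [searchWork, List.map_append, List.sum_append]

lemma length_le_searchWork (G : SocialNetwork n) (l : List (Fin n)) :
    l.length ≤ searchWork G l := by
  rw [← List.length_map (fun v => 1 + (G.inList v).length)]
  exact List.length_le_sum_of_one_le _ (by simp)

lemma cost_explore_add_le (G : SocialNetwork n) (live : Fin n → Fin n → Bool) (f : ℕ)
    (s : Search n) :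
    (explore G live f s).cost + s.found.length + searchWork G s.found ≤
      (explore G live f s).val.found.length + searchWork G (explore G live f s).val.found +
        searchWork G s.todo := by
  induction f generalizing s with
  | zero => simp [explore]
  | succ f ih =>
    obtain ⟨mark, todo, found⟩ := s
    cases todo with
    | nil => simp [explore]
    | cons v vs =>
      obtain ⟨new, htodo, hfound, hcost⟩ :=
        exists_scanLinks_eq_append live v (G.inList v) ⟨mark, vs, found⟩
      have hrest := ih (scanLinks live v (G.inList v) ⟨mark, vs, found⟩).val
      simp only [htodo, hfound, searchWork_append, List.length_append] at hrest
      simp only [explore, Timed.cost_bind, Timed.val_bind, cost_tick, hcost, searchWork_cons]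
      omega

lemma nodup_generateRR (G : SocialNetwork n) (d : Draw n) : (generateRR G d).val.Nodup :=
  (Search.WellFormed.explore ⟨by simp, by simp⟩ G d.2 n).1

lemma origin_mem_generateRR (G : SocialNetwork n) (d : Draw n) : d.1 ∈ (generateRR G d).val :=
  (found_suffix_explore G d.2 n
    ⟨Function.update (fun _ => false) d.1 true, [d.1], [d.1]⟩).mem (List.mem_singleton_self _)

/-- The work attributed to the RR set of a draw: its members and the links into them. -/
def workload (G : SocialNetwork n) (d : Draw n) : ℕ :=
  searchWork G (generateRR G d).val

lemma length_generateRR_le_workload (G : SocialNetwork n) (d : Draw n) :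
    (generateRR G d).val.length ≤ workload G d :=
  length_le_searchWork G _

lemma one_le_workload (G : SocialNetwork n) (d : Draw n) : 1 ≤ workload G d :=
  (List.length_pos_of_mem (origin_mem_generateRR G d)).trans_le (length_generateRR_le_workload G d)

lemma cost_generateRR_le (G : SocialNetwork n) (d : Draw n) :
    (generateRR G d).cost ≤ 3 * workload G d := by
  have hcost := cost_explore_add_le G d.2 n
    ⟨Function.update (fun _ => false) d.1 true, [d.1], [d.1]⟩
  have hlength := length_generateRR_le_workload G d
  simp only [generateRR, workload, Timed.cost_bind, Timed.val_bind, cost_tick, Timed.val_pure,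
    Timed.cost_pure, List.length_singleton] at hcost hlength ⊢
  omega

lemma length_inList (G : SocialNetwork n) (v : Fin n) :
    (G.inList v).length = (G.links.filter fun e => e.2 = v).card := by
  rw [SocialNetwork.inList, ← List.toFinset_card_of_nodup ((List.nodup_finRange n).filter _)]
  refine Finset.card_bij (fun u _ => (u, v)) (by simp) (by simp) ?_
  rintro ⟨u, v'⟩ hmem
  obtain ⟨hlink, rfl : v' = v⟩ := Finset.mem_filter.1 hmem
  exact ⟨u, by simpa using hlink, rfl⟩

lemma sum_length_inList (G : SocialNetwork n) : ∑ v, (G.inList v).length = G.links.card := by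
  simp_rw [length_inList]
  exact (Finset.card_eq_sum_card_fiberwise fun _ _ => Finset.mem_coe.2 (Finset.mem_univ _)).symm

lemma workload_eq_sum (G : SocialNetwork n) (d : Draw n) :
    workload G d = ∑ v, if v ∈ (generateRR G d).val then 1 + (G.inList v).length else 0 := by
  rw [workload, searchWork, ← List.sum_toFinset _ (nodup_generateRR G d), ← Finset.sum_filter]
  congr 1
  ext v
  simp

/-- The draws whose RR set contains `v`. -/
def drawsHitting (G : SocialNetwork n) (v : Fin n) : Set (Draw n) :=
  {d | v ∈ (generateRR G d).val}

lemma exists_lintegral_workload_le (G : SocialNetwork n) :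
    ∃ v, ∫⁻ d, workload G d ∂G.drawLaw ≤
      G.drawLaw (drawsHitting G v) * (n + G.links.card : ℕ) := by
  obtain ⟨v₀, -⟩ := G.exists_critical
  obtain ⟨v, -, hv⟩ := Finset.exists_max_image Finset.univ
    (fun v => G.drawLaw (drawsHitting G v)) ⟨v₀, Finset.mem_univ _⟩
  refine ⟨v, ?_⟩
  calc ∫⁻ d, workload G d ∂G.drawLaw
      = ∑ u, G.drawLaw (drawsHitting G u) * (1 + (G.inList u).length : ℕ) := by
        have hterm (u : Fin n) (d : Draw n) :
            (((if u ∈ (generateRR G d).val then 1 + (G.inList u).length else 0 : ℕ)) : ℝ≥0∞) =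
              (drawsHitting G u).indicator (fun _ => ((1 + (G.inList u).length : ℕ) : ℝ≥0∞)) d := by
          by_cases hu : u ∈ (generateRR G d).val <;> simp [drawsHitting, hu]
        simp_rw [workload_eq_sum, Nat.cast_sum, hterm]
        rw [lintegral_finsetSum _ fun u _ => Measurable.of_discrete]
        refine Finset.sum_congr rfl fun u _ => ?_
        rw [lintegral_indicator_const .of_discrete, mul_comm]
    _ ≤ ∑ u, G.drawLaw (drawsHitting G v) * (1 + (G.inList u).length : ℕ) :=
        Finset.sum_le_sum fun u _ => mul_le_mul_left (hv u (Finset.mem_univ u)) _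
    _ = G.drawLaw (drawsHitting G v) * (n + G.links.card : ℕ) := by
        rw [← Finset.mul_sum, ← Nat.cast_sum, Finset.sum_add_distrib, sum_length_inList]
        simp

end Search

/-! ### Cost and coverage of the greedy selection -/

section Greedy

variable {n : ℕ}

lemma sum_countP_mem {RR : List (List (Fin n))} (hRR : ∀ R ∈ RR, R.Nodup) :
    ∑ v, RR.countP (v ∈ ·) = (RR.map List.length).sum := by
  induction RR with
  | nil => simp
  | cons R RR ih =>
    rw [List.forall_mem_cons] at hRR
    have hR : ∑ v, (if v ∈ R then 1 else 0) = R.length := by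
      rw [Finset.sum_boole, ← List.toFinset_card_of_nodup hRR.1, Nat.cast_id]
      congr 1
      ext v
      simp
    simp [List.countP_cons, Finset.sum_add_distrib, ih hRR.2, hR, add_comm]

/-- `x` lists, for each node, the RR sets of `RR` that contain it, each with its number. -/
structure Incidence.IndexOf (x : Incidence n) (RR : List (List (Fin n))) : Prop where
  deg_eq : ∀ v, x.deg v = RR.countP (v ∈ ·)
  sets_eq : ∀ v, x.sets v = ((RR.zipIdx.filter (v ∈ ·.1)).map Prod.swap).reverse
  nodup_touched : x.touched.Nodup
  mem_touched : ∀ v, v ∈ x.touched ↔ x.deg v ≠ 0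

namespace Incidence.IndexOf

variable {x : Incidence n} {RR : List (List (Fin n))}

lemma length_sets (hx : x.IndexOf RR) (v : Fin n) : (x.sets v).length = x.deg v := by
  rw [hx.sets_eq, hx.deg_eq, List.length_reverse, List.length_map, ← List.countP_eq_length_filter]
  conv_rhs => rw [← List.zipIdx_map_fst 0 RR, List.countP_map]
  rfl

lemma nodup_numbers (hx : x.IndexOf RR) (v : Fin n) : ((x.sets v).map Prod.fst).Nodup := by
  rw [hx.sets_eq, List.map_reverse, List.nodup_reverse, List.map_map]
  refine List.Nodup.sublist (List.filter_sublist.map _) ?_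
  have hrange : RR.zipIdx.map (Prod.fst ∘ Prod.swap) = List.range' 0 RR.length :=
    List.zipIdx_map_snd 0 RR
  rw [hrange]
  exact List.nodup_range'

lemma getElem?_eq (hx : x.IndexOf RR) {v : Fin n} {e : ℕ × List (Fin n)} (he : e ∈ x.sets v) :
    RR[e.1]? = some e.2 := by
  rw [hx.sets_eq, List.mem_reverse, List.mem_map] at he
  obtain ⟨e', he', rfl⟩ := he
  exact List.mem_zipIdx_iff_getElem?.1 (List.mem_filter.1 he').1

lemma sum_map_deg_touched_le (hx : x.IndexOf RR) (hRR : ∀ R ∈ RR, R.Nodup) :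
    (x.touched.map x.deg).sum ≤ (RR.map List.length).sum := by
  rw [← List.sum_toFinset _ hx.nodup_touched, ← sum_countP_mem hRR]
  simp_rw [hx.deg_eq]
  exact Finset.sum_le_sum_of_subset (Finset.subset_univ _)

lemma length_touched_le (hx : x.IndexOf RR) : x.touched.length ≤ (x.touched.map x.deg).sum := by
  rw [← List.length_map x.deg]
  refine List.length_le_sum_of_one_le _ fun d hd => ?_
  obtain ⟨v, hv, rfl⟩ := List.mem_map.1 hd
  exact Nat.one_le_iff_ne_zero.2 ((hx.mem_touched v).1 hv)

end Incidence.IndexOf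

lemma cost_indexSet (i : ℕ) (R vs : List (Fin n)) (x : Incidence n) :
    (indexSet i R vs x).cost = vs.length := by
  fun_induction indexSet i R vs x <;> simp_all [add_comm]

lemma val_indexSet (i : ℕ) (R : List (Fin n)) {vs : List (Fin n)} (hvs : vs.Nodup)
    (x : Incidence n) :
    (indexSet i R vs x).val =
      ⟨fun v => x.deg v + if v ∈ vs then 1 else 0,
        fun v => if v ∈ vs then (i, R) :: x.sets v else x.sets v,
        (vs.filter (x.deg · = 0)).reverse ++ x.touched⟩ := by
  induction vs generalizing x with
  | nil => simp [indexSet]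
  | cons u vs ih =>
    obtain ⟨hu, hvs⟩ := List.nodup_cons.1 hvs
    have hfilter : vs.filter (Function.update x.deg u (x.deg u + 1) · = 0) =
        vs.filter (x.deg · = 0) :=
      List.filter_congr fun v hv => by rw [Function.update_of_ne (ne_of_mem_of_not_mem hv hu)]
    rw [indexSet, Timed.val_bind, ih hvs, hfilter]
    congr 1
    · ext v
      by_cases hv : v = u <;> simp [hv, hu]
    · ext v : 1
      by_cases hv : v = u <;> simp [hv, hu]
    · by_cases h : x.deg u = 0 <;> simp [h]

lemma Incidence.IndexOf.indexSet {x : Incidence n} {RR : List (List (Fin n))} (hx : x.IndexOf RR)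
    {R : List (Fin n)} (hR : R.Nodup) :
    (indexSet RR.length R R x).val.IndexOf (RR ++ [R]) := by
  rw [val_indexSet _ _ hR]
  refine ⟨fun v => ?_, fun v => ?_, ?_, fun v => ?_⟩
  · simp [hx.deg_eq, List.countP_cons]
  · by_cases hv : v ∈ R <;> simp [hx.sets_eq, List.zipIdx_append, hv]
  · refine (List.nodup_reverse.2 (hR.filter _)).append hx.nodup_touched fun v hv hv' => ?_
    simp_all [hx.mem_touched]
  · by_cases hv : v ∈ R <;> by_cases h : x.deg v = 0 <;> simp [hx.mem_touched, hv, h]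

lemma cost_indexAll (i : ℕ) (RR : List (List (Fin n))) (x : Incidence n) :
    (indexAll i RR x).cost = RR.length + (RR.map List.length).sum := by
  fun_induction indexAll i RR x with
  | case1 => rfl
  | case2 i R RR x ih =>
    simp only [Timed.cost_bind, cost_tick, cost_indexSet, ih, List.length_cons, List.map_cons,
      List.sum_cons]
    omega

lemma Incidence.IndexOf.indexAll {x : Incidence n} {RR : List (List (Fin n))} (hx : x.IndexOf RR)
    {RR' : List (List (Fin n))} (hRR' : ∀ R ∈ RR', R.Nodup) :
    (indexAll RR.length RR' x).val.IndexOf (RR ++ RR') := by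
  induction RR' generalizing RR x with
  | nil => simpa [TargetedIM.indexAll] using hx
  | cons R RR' ih =>
    rw [List.forall_mem_cons] at hRR'
    simpa [TargetedIM.indexAll] using ih (hx.indexSet hRR'.1) hRR'.2

lemma indexOf_indexAll_zero {RR : List (List (Fin n))} (hRR : ∀ R ∈ RR, R.Nodup) :
    (indexAll 0 RR ⟨fun _ => 0, fun _ => [], []⟩).val.IndexOf RR :=
  Incidence.IndexOf.indexAll (RR := []) ⟨by simp, by simp, by simp, by simp⟩ hRR

lemma cost_fillBuckets (deg : Fin n → ℕ) (vs : List (Fin n)) (b : ℕ → List (Fin n)) :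
    (fillBuckets deg vs b).cost = vs.length := by
  fun_induction fillBuckets deg vs b <;> simp_all [add_comm]

lemma mem_fillBuckets (deg : Fin n → ℕ) (vs : List (Fin n)) (b : ℕ → List (Fin n)) (d : ℕ)
    (u : Fin n) :
    u ∈ (fillBuckets deg vs b).val d ↔ u ∈ b d ∨ (u ∈ vs ∧ deg u = d) := by
  fun_induction fillBuckets deg vs b with
  | case1 => simp
  | case2 v vs b ih =>
    rw [Timed.val_bind, ih, List.mem_cons]
    by_cases hd : d = deg v
    · subst hd
      rw [Function.update_self, List.mem_cons]
      grind
    · rw [Function.update_of_ne hd]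
      grind

/-- Each node in the buckets `0, …, d` counts with the number of its RR sets plus the number of its
bucket; this pays for covering its sets and for moving it down to lower buckets. -/
def bucketPotential (sets : Fin n → List (ℕ × List (Fin n))) (b : ℕ → List (Fin n)) (d : ℕ) : ℕ :=
  ∑ j ∈ Finset.range (d + 1), ((b j).map fun v => (sets v).length + j).sum

lemma bucketPotential_succ (sets : Fin n → List (ℕ × List (Fin n))) (b : ℕ → List (Fin n))
    (d : ℕ) : bucketPotential sets b (d + 1) =
      bucketPotential sets b d + ((b (d + 1)).map fun v => (sets v).length + (d + 1)).sum :=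
  Finset.sum_range_succ _ _

lemma bucketPotential_update_le (sets : Fin n → List (ℕ × List (Fin n))) (b : ℕ → List (Fin n))
    (d j : ℕ) (v : Fin n) :
    bucketPotential sets (Function.update b j (v :: b j)) d ≤
      bucketPotential sets b d + ((sets v).length + j) := by
  have hterm (i : ℕ) : ((Function.update b j (v :: b j) i).map fun u => (sets u).length + i).sum =
      ((b i).map fun u => (sets u).length + i).sum + if i = j then (sets v).length + j else 0 := by
    by_cases h : i = j
    · subst h
      simp [add_comm]
    · simp [h]
  simp_rw [bucketPotential, hterm]
  rw [Finset.sum_add_distrib, Finset.sum_ite_eq']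
  split_ifs <;> omega

lemma bucketPotential_fillBuckets_le (sets : Fin n → List (ℕ × List (Fin n))) (deg : Fin n → ℕ)
    (vs : List (Fin n)) (b : ℕ → List (Fin n)) (d : ℕ) :
    bucketPotential sets (fillBuckets deg vs b).val d ≤
      bucketPotential sets b d + (vs.map fun v => (sets v).length + deg v).sum := by
  fun_induction fillBuckets deg vs b with
  | case1 => simp
  | case2 v vs b ih =>
    have hv := bucketPotential_update_le sets b d (deg v) v
    rw [Timed.val_bind, List.map_cons, List.sum_cons]
    omega

/-- The total size of the RR sets that are not covered. -/
def uncoveredSize (RR : List (List (Fin n))) (covered : ℕ → Bool) : ℕ :=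
  ∑ i : Fin RR.length, if covered i = true then 0 else RR[i].length

lemma uncoveredSize_false (RR : List (List (Fin n))) :
    uncoveredSize RR (fun _ => false) = (RR.map List.length).sum := by
  simp only [uncoveredSize, Bool.false_eq_true, if_false, Fin.getElem_fin]
  rw [← Fin.sum_univ_fun_getElem]

lemma uncoveredSize_update {RR : List (List (Fin n))} {covered : ℕ → Bool} {i : ℕ}
    {R : List (Fin n)} (hR : RR[i]? = some R) (hi : covered i = false) :
    uncoveredSize RR (Function.update covered i true) + R.length = uncoveredSize RR covered := by
  obtain ⟨hlt, rfl⟩ := List.getElem?_eq_some_iff.1 hR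
  have hterm (j : Fin RR.length) : (if covered j = true then 0 else RR[j].length) =
      (if Function.update covered i true j = true then 0 else RR[j].length) +
        if j = ⟨i, hlt⟩ then RR[i].length else 0 := by
    by_cases hj : j = ⟨i, hlt⟩
    · subst hj
      simp [hi]
    · have hj' : (j : ℕ) ≠ i := fun h => hj (Fin.ext h)
      simp [hj, hj']
  simp_rw [uncoveredSize, hterm]
  rw [Finset.sum_add_distrib, Fintype.sum_ite_eq']

lemma cost_lowerDegrees (us : List (Fin n)) (deg : Fin n → ℕ) :
    (lowerDegrees us deg).cost = us.length := by
  fun_induction lowerDegrees us deg <;> simp_all [add_comm]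

lemma lowerDegrees_le (us : List (Fin n)) (deg : Fin n → ℕ) : (lowerDegrees us deg).val ≤ deg := by
  fun_induction lowerDegrees us deg with
  | case1 => exact le_rfl
  | case2 u us deg ih => exact ih.trans (update_le_self_iff.2 (Nat.sub_le _ _))

lemma bucket_coverSets (es : List (ℕ × List (Fin n))) (s : Greedy n) :
    (coverSets es s).val.bucket = s.bucket := by
  fun_induction coverSets es s with
  | case1 => rfl
  | case2 i R es s ih_covered ih_uncovered =>
    rw [Timed.val_bind]
    split_ifs
    · exact ih_covered
    · exact ih_uncovered _

lemma deg_coverSets_le (es : List (ℕ × List (Fin n))) (s : Greedy n) :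
    (coverSets es s).val.deg ≤ s.deg := by
  fun_induction coverSets es s with
  | case1 => exact le_rfl
  | case2 i R es s ih_covered ih_uncovered =>
    rw [Timed.val_bind]
    split_ifs
    · exact ih_covered
    · exact (ih_uncovered _).trans (lowerDegrees_le R s.deg)

lemma gain_le_gain_coverSets (es : List (ℕ × List (Fin n))) (s : Greedy n) :
    s.gain ≤ (coverSets es s).val.gain := by
  fun_induction coverSets es s with
  | case1 => exact le_rfl
  | case2 i R es s ih_covered ih_uncovered =>
    rw [Timed.val_bind]
    split_ifs
    · exact ih_covered
    · exact (Nat.le_succ _).trans (ih_uncovered _)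

lemma gain_coverSets {es : List (ℕ × List (Fin n))} (hes : (es.map Prod.fst).Nodup) {s : Greedy n}
    (hs : ∀ e ∈ es, s.covered e.1 = false) :
    (coverSets es s).val.gain = s.gain + es.length := by
  fun_induction coverSets es s with
  | case1 => rfl
  | case2 i R es s _ ih_uncovered =>
    obtain ⟨hmem, hnodup⟩ := List.nodup_cons.1 hes
    rw [List.forall_mem_cons] at hs
    rw [Timed.val_bind, if_neg (Bool.eq_false_iff.1 hs.1)]
    refine (ih_uncovered _ hnodup fun e he => ?_).trans (Nat.succ_add_eq_add_succ _ _)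
    have hne : e.1 ≠ i := fun h => hmem (List.mem_map.2 ⟨e, he, h⟩)
    exact (Function.update_of_ne hne ..).trans (hs.2 e he)

lemma cost_coverSets_add_le {RR : List (List (Fin n))} {es : List (ℕ × List (Fin n))}
    (hes : ∀ e ∈ es, RR[e.1]? = some e.2) (s : Greedy n) :
    (coverSets es s).cost + uncoveredSize RR (coverSets es s).val.covered ≤
      es.length + uncoveredSize RR s.covered := by
  fun_induction coverSets es s with
  | case1 => simp
  | case2 i R es s ih_covered ih_uncovered =>
    rw [List.forall_mem_cons] at hes
    rw [Timed.cost_bind, Timed.val_bind, List.length_cons]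
    split_ifs with hi
    · have hrest := ih_covered hes.2
      simp only [cost_tick]
      omega
    · have hrest := ih_uncovered (lowerDegrees R s.deg).val hes.2
      have hcover := uncoveredSize_update hes.1 (Bool.eq_false_of_not_eq_true hi)
      simp only [Timed.cost_bind, Timed.val_bind, cost_tick, cost_lowerDegrees] at hcover hrest ⊢
      omega

/-- No node has a degree above the number of its bucket. -/
def Greedy.Sorted (s : Greedy n) : Prop :=
  ∀ d, ∀ v ∈ s.bucket d, s.deg v ≤ d

lemma Greedy.Sorted.serveBucket {s : Greedy n} (hs : s.Sorted)
    (sets : Fin n → List (ℕ × List (Fin n))) (d : ℕ) (vs : List (Fin n)) :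
    (serveBucket sets d vs s).val.Sorted := by
  fun_induction TargetedIM.serveBucket sets d vs s with
  | case1 => exact hs
  | case2 v vs s ih_chosen ih_moved =>
    rw [Timed.val_bind]
    split_ifs
    · exact hs
    · refine ih_chosen _ fun j u hu => ?_
      rw [bucket_coverSets] at hu
      exact (deg_coverSets_le _ _ u).trans (hs j u hu)
    · refine ih_moved fun j u hu => ?_
      by_cases hj : j = s.deg v
      · subst hj
        rcases List.mem_cons.1 (by simpa using hu) with rfl | hu
        · exact le_rfl
        · exact hs _ u hu
      · exact hs j u (by simpa [hj] using hu)

lemma cost_serveBucket_add_le {sets : Fin n → List (ℕ × List (Fin n))} {RR : List (List (Fin n))}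
    (hsets : ∀ v, ∀ e ∈ sets v, RR[e.1]? = some e.2) (d : ℕ) (vs : List (Fin n))
    (s : Greedy n) (hs : ∀ v ∈ vs, s.deg v ≤ d + 1) :
    (serveBucket sets (d + 1) vs s).cost +
        bucketPotential sets (serveBucket sets (d + 1) vs s).val.bucket d +
        uncoveredSize RR (serveBucket sets (d + 1) vs s).val.covered ≤
      (vs.map fun v => (sets v).length + (d + 1)).sum + bucketPotential sets s.bucket d +
        uncoveredSize RR s.covered := by
  fun_induction serveBucket sets (d + 1) vs s with
  | case1 => simp
  | case2 v vs s ih_chosen ih_moved =>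
    rw [List.forall_mem_cons] at hs
    rw [Timed.cost_bind, Timed.val_bind, List.map_cons, List.sum_cons, cost_tick]
    split_ifs with hleft hdeg
    · simp only [Timed.cost_pure, Timed.val_pure]
      omega
    · let s' : Greedy n := ⟨s.deg, s.covered, s.bucket, s.left - 1, v :: s.seeds, s.gain⟩
      have hcover := cost_coverSets_add_le (hsets v) s'
      have hrest := ih_chosen (coverSets (sets v) s').val fun u hu =>
        (deg_coverSets_le (sets v) s' u).trans (hs.2 u hu)
      rw [bucket_coverSets] at hrest
      simp only [s', Timed.cost_bind, Timed.val_bind] at hcover hrest ⊢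
      omega
    · have hrest := ih_moved hs.2
      have hmove := bucketPotential_update_le sets s.bucket d (s.deg v) v
      have hlt : s.deg v ≤ d := by omega
      simp only at hrest
      omega

lemma cost_serveBuckets_le {sets : Fin n → List (ℕ × List (Fin n))} {RR : List (List (Fin n))}
    (hsets : ∀ v, ∀ e ∈ sets v, RR[e.1]? = some e.2) (d : ℕ) {s : Greedy n} (hs : s.Sorted) :
    (serveBuckets sets d s).cost ≤
      d + bucketPotential sets s.bucket d + uncoveredSize RR s.covered := by
  induction d generalizing s with
  | zero => simp [serveBuckets]
  | succ d ih =>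
    have hbucket := cost_serveBucket_add_le hsets d (s.bucket (d + 1)) s (hs _)
    have hrest := ih (hs.serveBucket sets (d + 1) (s.bucket (d + 1)))
    rw [bucketPotential_succ]
    simp only [serveBuckets, Timed.cost_bind, cost_tick]
    omega

lemma gain_le_gain_serveBucket (sets : Fin n → List (ℕ × List (Fin n))) (d : ℕ)
    (vs : List (Fin n)) (s : Greedy n) : s.gain ≤ (serveBucket sets d vs s).val.gain := by
  fun_induction serveBucket sets d vs s with
  | case1 => exact le_rfl
  | case2 v vs s ih_chosen ih_moved =>
    rw [Timed.val_bind]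
    split_ifs
    · exact le_rfl
    · exact (gain_le_gain_coverSets (sets v)
        ⟨s.deg, s.covered, s.bucket, s.left - 1, v :: s.seeds, s.gain⟩).trans (ih_chosen _)
    · exact ih_moved

lemma gain_le_gain_serveBuckets (sets : Fin n → List (ℕ × List (Fin n))) (d : ℕ) (s : Greedy n) :
    s.gain ≤ (serveBuckets sets d s).val.gain := by
  induction d generalizing s with
  | zero => exact le_rfl
  | succ d ih => exact (gain_le_gain_serveBucket sets _ _ s).trans (ih _)

-- The first node chosen has the greatest degree, and all its RR sets become covered.
lemma deg_le_gain_serveBuckets {sets : Fin n → List (ℕ × List (Fin n))} {s : Greedy n}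
    (hleft : s.left ≠ 0) (hcovered : ∀ i, s.covered i = false)
    (hbucket : ∀ u j, 0 < j → (u ∈ s.bucket j ↔ s.deg u = j))
    (hlength : ∀ u, (sets u).length = s.deg u) (hnodup : ∀ u, ((sets u).map Prod.fst).Nodup)
    {d : ℕ} {v : Fin n} (hv : s.deg v ≤ d) :
    s.deg v ≤ (serveBuckets sets d s).val.gain := by
  induction d with
  | zero => omega
  | succ d ih =>
    rw [serveBuckets]
    simp only [Timed.val_bind]
    cases hb : s.bucket (d + 1) with
    | nil =>
      have hne : s.deg v ≠ d + 1 := fun h => by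
        simpa [hb] using (hbucket v (d + 1) d.succ_pos).2 h
      exact ih (by omega)
    | cons u us =>
      have hu : s.deg u = d + 1 := (hbucket u (d + 1) d.succ_pos).1 (by simp [hb])
      refine le_trans ?_ (gain_le_gain_serveBuckets sets d _)
      rw [serveBucket, if_neg hleft, if_pos hu]
      refine le_trans ?_ (gain_le_gain_serveBucket sets (d + 1) us _)
      have hgain := gain_coverSets (hnodup u)
        (s := ⟨s.deg, s.covered, s.bucket, s.left - 1, u :: s.seeds, s.gain⟩)
        fun e _ => hcovered e.1
      rw [hgain, hlength, hu]
      exact hv.trans (Nat.le_add_left _ _)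

lemma cost_greedyMC_le (k : ℕ) {RR : List (List (Fin n))} (hRR : ∀ R ∈ RR, R.Nodup) :
    (greedyMC k RR).cost ≤ 1 + 3 * RR.length + 6 * (RR.map List.length).sum := by
  have hx := indexOf_indexAll_zero hRR
  have hindex := cost_indexAll 0 RR (⟨fun _ => 0, fun _ => [], []⟩ : Incidence n)
  set x := (indexAll 0 RR ⟨fun _ => 0, fun _ => [], []⟩).val with hx_def
  set b := (fillBuckets x.deg x.touched (fun _ => [])).val with hb_def
  have hsorted : (⟨x.deg, fun _ => false, b, k, [], 0⟩ : Greedy n).Sorted := fun d v hv => by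
    simp only [hb_def, mem_fillBuckets, List.not_mem_nil, false_or] at hv
    exact hv.2.le
  have hpotential : bucketPotential x.sets b RR.length ≤ 2 * (x.touched.map x.deg).sum := by
    refine (bucketPotential_fillBuckets_le x.sets x.deg x.touched _ RR.length).trans_eq ?_
    simp [bucketPotential, hx.length_sets, ← two_mul, List.sum_map_mul_left]
  have hserve := cost_serveBuckets_le (sets := x.sets) (fun v e he => hx.getElem?_eq he) RR.length
    hsorted
  rw [uncoveredSize_false] at hserve
  have hdeg := hx.sum_map_deg_touched_le hRR
  have htouched := hx.length_touched_le
  simp only [greedyMC, Timed.cost_bind, cost_tick, Timed.cost_pure, cost_fillBuckets, ← hx_def,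
    ← hb_def] at hserve ⊢
  omega

lemma countP_le_greedyMC {k : ℕ} (hk : 1 ≤ k) {RR : List (List (Fin n))}
    (hRR : ∀ R ∈ RR, R.Nodup) (v : Fin n) :
    RR.countP (v ∈ ·) ≤ (greedyMC k RR).val.2 := by
  have hx := indexOf_indexAll_zero hRR
  set x := (indexAll 0 RR ⟨fun _ => 0, fun _ => [], []⟩).val
  set s : Greedy n :=
    ⟨x.deg, fun _ => false, (fillBuckets x.deg x.touched (fun _ => [])).val, k, [], 0⟩
  have hbucket (u : Fin n) (j : ℕ) (hj : 0 < j) : u ∈ s.bucket j ↔ s.deg u = j := by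
    simp only [s, mem_fillBuckets, hx.mem_touched, List.not_mem_nil, false_or]
    omega
  have hdeg : s.deg v = RR.countP (v ∈ ·) := hx.deg_eq v
  have hle : s.deg v ≤ RR.length := hdeg ▸ List.countP_le_length
  rw [← hdeg]
  exact deg_le_gain_serveBuckets (Nat.one_le_iff_ne_zero.1 hk) (fun _ => rfl) hbucket
    hx.length_sets hx.nodup_numbers hle

end Greedy

/-! ### The rounds of the main loop -/

section Rounds

variable {n : ℕ} (G : SocialNetwork n) (tape : ℕ → Draw n)

/-- The collection of the first `N` RR sets of a tape, the last one first. -/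
def rrPrefix : ℕ → List (List (Fin n))
  | 0 => []
  | N + 1 => (generateRR G (tape N)).val :: rrPrefix N

lemma length_rrPrefix (N : ℕ) : (rrPrefix G tape N).length = N := by
  induction N with
  | zero => rfl
  | succ N ih => rw [rrPrefix, List.length_cons, ih]

lemma nodup_of_mem_rrPrefix (N : ℕ) : ∀ R ∈ rrPrefix G tape N, R.Nodup := by
  induction N with
  | zero => exact List.forall_mem_nil _
  | succ N ih => exact List.forall_mem_cons.2 ⟨nodup_generateRR G _, ih⟩

lemma countP_rrPrefix (v : Fin n) (N : ℕ) :
    (rrPrefix G tape N).countP (v ∈ ·) = hitCount (drawsHitting G v) (Finset.range N) tape := by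
  induction N with
  | zero => rfl
  | succ N ih =>
    rw [rrPrefix, List.countP_cons, ih, hitCount, hitCount, Finset.card_filter,
      Finset.card_filter, Finset.sum_range_succ]
    by_cases hv : v ∈ (generateRR G (tape N)).val <;> simp [drawsHitting, hv]

lemma sum_length_rrPrefix_le (N : ℕ) :
    ((rrPrefix G tape N).map List.length).sum ≤ ∑ i ∈ Finset.range N, workload G (tape i) := by
  induction N with
  | zero => rfl
  | succ N ih =>
    rw [rrPrefix, List.map_cons, List.sum_cons, Finset.sum_range_succ, add_comm]
    exact add_le_add ih (length_generateRR_le_workload G _)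

lemma le_sum_workload (N : ℕ) : N ≤ ∑ i ∈ Finset.range N, workload G (tape i) := by
  simpa using Finset.card_nsmul_le_sum (Finset.range N) _ 1 fun i _ => one_le_workload G (tape i)

lemma val_generateMany_rrPrefix (c N : ℕ) :
    (generateMany G tape c (rrPrefix G tape N)).val = rrPrefix G tape (N + c) := by
  induction c generalizing N with
  | zero => rfl
  | succ c ih =>
    rw [generateMany, Timed.val_bind, Timed.val_bind, length_rrPrefix, ← Nat.succ_add_eq_add_succ]
    exact ih (N + 1)

lemma cost_generateMany_add_le (c N : ℕ) :
    (generateMany G tape c (rrPrefix G tape N)).cost +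
        4 * ∑ i ∈ Finset.range N, workload G (tape i) ≤
      4 * ∑ i ∈ Finset.range (N + c), workload G (tape i) := by
  induction c generalizing N with
  | zero => simp [generateMany]
  | succ c ih =>
    have hrest := ih (N + 1)
    rw [Finset.sum_range_succ, rrPrefix, Nat.succ_add_eq_add_succ, Nat.succ_eq_add_one] at hrest
    have hcost := cost_generateRR_le G (tape N)
    have hone := one_le_workload G (tape N)
    simp only [generateMany, Timed.cost_bind, length_rrPrefix, cost_tick]
    omega

/-- The check point `N_R⁰` at the beginning of the round `r`, the first round being number `0`. -/
noncomputable def roundLo (γ : ℝ) : ℕ → ℝ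
  | 0 => 1
  | r + 1 => 2 ^ r * γ

/-- The number of RR sets at the beginning of the round `r`. -/
noncomputable def roundSize (γ : ℝ) : ℕ → ℕ
  | 0 => 0
  | r + 1 => roundSize γ r + (⌊2 ^ r * γ - roundLo γ r⌋₊ + 1)

-- Each round but the first one may generate one RR set more than `N_R - N_R⁰`.
lemma roundSize_succ_le_add {γ : ℝ} (hγ : 1 ≤ γ) (r : ℕ) :
    (roundSize γ (r + 1) : ℝ) ≤ 2 ^ r * γ + r := by
  induction r with
  | zero =>
    have hfloor := Nat.floor_le (sub_nonneg.2 hγ)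
    simp only [roundSize, roundLo, pow_zero, one_mul]
    push_cast
    linarith
  | succ r ih =>
    have hpos : 0 ≤ 2 ^ r * γ := by positivity
    have hfloor := Nat.floor_le (show 0 ≤ 2 ^ (r + 1) * γ - 2 ^ r * γ by rw [pow_succ]; linarith)
    rw [roundSize, roundLo]
    push_cast
    linarith

lemma roundSize_succ_le {γ : ℝ} (hγ : 1 ≤ γ) (r : ℕ) :
    (roundSize γ (r + 1) : ℝ) ≤ 2 * (2 ^ r * γ) := by
  have hr : (r : ℝ) ≤ 2 ^ r * γ :=
    (mod_cast Nat.lt_two_pow_self.le : (r : ℝ) ≤ 2 ^ r).trans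
      (le_mul_of_one_le_right (by positivity) hγ)
  linarith [roundSize_succ_le_add hγ r]

lemma le_roundSize_succ (γ : ℝ) (r : ℕ) :
    2 ^ r * γ / 2 ≤ (roundSize γ (r + 1) : ℝ) := by
  have hfloor := Nat.lt_floor_add_one (2 ^ r * γ - roundLo γ r)
  have hsize : (0 : ℝ) ≤ roundSize γ r := Nat.cast_nonneg _
  rw [roundSize]
  push_cast
  cases r with
  | zero =>
    have hnonneg : (0 : ℝ) ≤ ⌊(2 : ℝ) ^ 0 * γ - roundLo γ 0⌋₊ := Nat.cast_nonneg _
    simp only [roundLo, pow_zero, one_mul] at *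
    linarith
  | succ r =>
    simp only [roundLo, pow_succ] at *
    linarith

/-- The invariant of the main loop: `s` is the state at the beginning of the round `r`. -/
structure Main.AtRound (γ : ℝ) (r : ℕ) (s : Main n) : Prop where
  RR_eq : s.RR = rrPrefix G tape (roundSize γ r)
  lo_eq : s.lo = roundLo γ r
  hi_eq : s.hi = 2 ^ r * γ
  hitCount_le_deg :
    ∀ v, hitCount (drawsHitting G v) (Finset.range (roundSize γ r)) tape ≤ s.deg

lemma Main.atRound_zero (γ : ℝ) : (⟨[], 1, γ, [], 0⟩ : Main n).AtRound G tape γ 0 :=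
  ⟨rfl, rfl, by simp, fun _ => le_rfl⟩

namespace Main.AtRound

variable {G tape} {k : ℕ} {γ : ℝ} {r : ℕ} {s : Main n}

lemma val_generateMany (hs : s.AtRound G tape γ r) :
    (generateMany G tape (⌊s.hi - s.lo⌋₊ + 1) s.RR).val =
      rrPrefix G tape (roundSize γ (r + 1)) := by
  rw [hs.RR_eq, hs.hi_eq, hs.lo_eq, val_generateMany_rrPrefix, roundSize]

lemma mainBody (hs : s.AtRound G tape γ r) (hk : 1 ≤ k) :
    (mainBody G k tape s).val.AtRound G tape γ (r + 1) where
  RR_eq := hs.val_generateMany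
  lo_eq := hs.hi_eq
  hi_eq := by
    simp only [TargetedIM.mainBody, Timed.val_bind, Timed.val_pure, hs.hi_eq, pow_succ']
    ring
  hitCount_le_deg v := by
    simp only [TargetedIM.mainBody, Timed.val_bind, Timed.val_pure, hs.val_generateMany,
      ← countP_rrPrefix]
    exact countP_le_greedyMC hk (nodup_of_mem_rrPrefix G tape _) v

lemma cost_mainBody_lt (hs : s.AtRound G tape γ r) :
    (TargetedIM.mainBody G k tape s).cost <
      16 * ∑ i ∈ Finset.range (roundSize γ (r + 1)), workload G (tape i) := by
  have hsize : roundSize γ r + (⌊s.hi - s.lo⌋₊ + 1) = roundSize γ (r + 1) := by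
    rw [hs.hi_eq, hs.lo_eq, roundSize]
  have hpos : 1 ≤ roundSize γ (r + 1) := hsize ▸ Nat.le_add_left _ _
  have hgenerate := cost_generateMany_add_le G tape (⌊s.hi - s.lo⌋₊ + 1) (roundSize γ r)
  have hgreedy := cost_greedyMC_le k (nodup_of_mem_rrPrefix G tape (roundSize γ (r + 1)))
  have hlength := sum_length_rrPrefix_le G tape (roundSize γ (r + 1))
  have hwork := le_sum_workload G tape (roundSize γ (r + 1))
  rw [hsize, ← hs.RR_eq] at hgenerate
  rw [length_rrPrefix] at hgreedy
  simp only [TargetedIM.mainBody, Timed.cost_bind, cost_tick, Timed.cost_pure, hs.val_generateMany]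
  omega

lemma cost_mainLoop_le (hs : s.AtRound G tape γ r) (hk : 1 ≤ k) (v : Fin n) (f : ℕ) :
    (mainLoop G k γ tape f s).cost ≤ 1 + ∑ j ∈ Finset.range f,
      if (hitCount (drawsHitting G v) (Finset.range (roundSize γ (r + j))) tape : ℝ) < γ then
        16 * ∑ i ∈ Finset.range (roundSize γ (r + j + 1)), workload G (tape i) else 0 := by
  induction f generalizing r s with
  | zero => simp [mainLoop]
  | succ f ih =>
    rw [mainLoop, Finset.sum_range_succ', Timed.cost_bind, cost_tick]
    split_ifs with hdeg hhit
    · have hrest := ih (hs.mainBody hk)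
      have hbody := hs.cost_mainBody_lt (k := k)
      simp only [Timed.cost_bind, add_assoc, add_comm 1, add_zero] at hrest hbody ⊢
      omega
    · exact absurd ((Nat.cast_le.2 (hs.hitCount_le_deg v)).trans_lt hdeg) hhit
    all_goals simp

end Main.AtRound

lemma cost_targetedIM_le {k : ℕ} (hk : 1 ≤ k) (γ : ℝ) (v : Fin n) (f : ℕ) :
    (targetedIM G k γ tape f).cost ≤ n + 1 + ∑ r ∈ Finset.range f,
      if (hitCount (drawsHitting G v) (Finset.range (roundSize γ r)) tape : ℝ) < γ then
        16 * ∑ i ∈ Finset.range (roundSize γ (r + 1)), workload G (tape i) else 0 := by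
  have hloop := (Main.atRound_zero G tape γ).cost_mainLoop_le hk v f
  simp only [zero_add] at hloop
  simp only [targetedIM, Timed.cost_bind, cost_tick]
  omega

end Rounds

section Measurability

variable {n : ℕ} (G : SocialNetwork n) (k : ℕ) (γ : ℝ) (tape : ℕ → Draw n)

-- A tape near `tape` in the product topology agrees with it on a long initial segment.
lemma eventually_generateMany_eq (c : ℕ) (RR : List (List (Fin n))) :
    ∀ᶠ tape' in nhds tape, generateMany G tape' c RR = generateMany G tape c RR := by
  induction c generalizing RR with
  | zero => exact .of_forall fun _ => rfl
  | succ c ih =>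
    have hread : ∀ᶠ tape' in nhds tape, tape' RR.length = tape RR.length :=
      (continuousAt_apply (A := fun _ => Draw n) RR.length tape).eventually_mem
        (mem_nhds_discrete.2 (Set.mem_singleton _))
    filter_upwards [hread, ih ((generateRR G (tape RR.length)).val :: RR)] with tape' hread hrest
    rw [generateMany, generateMany, hread]
    exact congrArg _ (funext fun _ => Timed.bind_congr hrest)

lemma eventually_mainLoop_eq (f : ℕ) (s : Main n) :
    ∀ᶠ tape' in nhds tape, mainLoop G k γ tape' f s = mainLoop G k γ tape f s := by
  induction f generalizing s with
  | zero => exact .of_forall fun _ => rfl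
  | succ f ih =>
    have hbody : ∀ᶠ tape' in nhds tape, mainBody G k tape' s = mainBody G k tape s := by
      filter_upwards [eventually_generateMany_eq G tape _ s.RR] with tape' h
      rw [mainBody, mainBody, h]
    filter_upwards [hbody, ih (mainBody G k tape s).val] with tape' hbody hrest
    rw [mainLoop, mainLoop, hbody]
    split_ifs
    · exact congrArg _ (funext fun _ => Timed.bind_congr hrest)
    · rfl

lemma isLocallyConstant_targetedIM (f : ℕ) :
    IsLocallyConstant fun tape => targetedIM G k γ tape f := by
  refine (IsLocallyConstant.iff_eventually_eq _).2 fun tape => ?_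
  filter_upwards [eventually_mainLoop_eq G k γ tape f _] with tape' h
  rw [targetedIM, targetedIM, h]

lemma measurable_runningTime : Measurable (runningTime G k γ) := by
  have : OpensMeasurableSpace (ℕ → Draw n) := Pi.opensMeasurableSpace
  exact .iSup fun f =>
    ((isLocallyConstant_targetedIM G k γ f).comp fun x => (x.cost : ℝ≥0∞)).continuous.measurable

end Measurability

/-! ### The expected running time -/

section RunningTime

variable {n : ℕ} (G : SocialNetwork n) {k : ℕ} {γ : ℝ}

/-- The tapes on which `v` lies in fewer than `γ` of the RR sets generated before the round `r`. -/
def rarelyHitting (γ : ℝ) (v : Fin n) (r : ℕ) : Set (ℕ → Draw n) :=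
  {tape | (hitCount (drawsHitting G v) (Finset.range (roundSize γ r)) tape : ℝ) < γ}

lemma measurableSet_rarelyHitting (γ : ℝ) (v : Fin n) (r : ℕ) :
    MeasurableSet (rarelyHitting G γ v r) :=
  measurableSet_lt (measurable_hitCount .of_discrete _) measurable_const

lemma runningTime_le (hk : 1 ≤ k) (γ : ℝ) (v : Fin n) (tape : ℕ → Draw n) :
    runningTime G k γ tape ≤ (n + 1 : ℕ) + 16 * ∑' r, (rarelyHitting G γ v r).indicator
      (fun ω => ∑ i ∈ Finset.range (roundSize γ (r + 1)), (workload G (ω i) : ℝ≥0∞)) tape := by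
  classical
  refine iSup_le fun f => ?_
  calc ((targetedIM G k γ tape f).cost : ℝ≥0∞)
      ≤ (n + 1 : ℕ) + 16 * ∑ r ∈ Finset.range f, (rarelyHitting G γ v r).indicator
          (fun ω => ∑ i ∈ Finset.range (roundSize γ (r + 1)), (workload G (ω i) : ℝ≥0∞)) tape := by
        refine (Nat.cast_le.2 (cost_targetedIM_le G tape hk γ v f)).trans_eq ?_
        rw [Nat.cast_add, Nat.cast_sum, Finset.mul_sum]
        congr! 2 with r
        simp only [rarelyHitting, Set.indicator_apply, Set.mem_ofPred_eq]
        split_ifs <;> simp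
    _ ≤ _ := by
        gcongr
        exact ENNReal.sum_le_tsum _

lemma lintegral_tsum_rarelyHitting_le (hγ : 1 ≤ γ) {v : Fin n}
    (hv : ∫⁻ d, workload G d ∂G.drawLaw ≤ G.drawLaw (drawsHitting G v) * (n + G.links.card : ℕ)) :
    ∫⁻ tape, ∑' r, (rarelyHitting G γ v r).indicator
        (fun ω => ∑ i ∈ Finset.range (roundSize γ (r + 1)), (workload G (ω i) : ℝ≥0∞)) tape
        ∂G.tapeLaw ≤
      ENNReal.ofReal ((2 + 32 * Real.exp (3 / 2)) * γ) * (n + G.links.card : ℕ) := by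
  have hmeas (r : ℕ) : Measurable fun ω : ℕ → Draw n =>
      ∑ i ∈ Finset.range (roundSize γ (r + 1)), (workload G (ω i) : ℝ≥0∞) :=
    Finset.measurable_fun_sum _ fun i _ =>
      (Measurable.of_discrete (f := fun d => (workload G d : ℝ≥0∞))).comp (measurable_pi_apply i)
  rw [lintegral_tsum fun r =>
    ((hmeas r).indicator (measurableSet_rarelyHitting G γ v r)).aemeasurable]
  simp_rw [lintegral_indicator (measurableSet_rarelyHitting G γ v _)]
  exact tsum_setLIntegral_doubling_le G.drawLaw .of_discrete .of_discrete hv hγ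
    (le_roundSize_succ γ) (roundSize_succ_le hγ)

lemma expectedRunningTime_le (hk : 1 ≤ k) (hγ : 1 ≤ γ) :
    expectedRunningTime G k γ ≤
      ENNReal.ofReal ((34 + 512 * Real.exp (3 / 2)) * (γ * (n + G.links.card))) := by
  obtain ⟨v, hv⟩ := exists_lintegral_workload_le G
  have : IsProbabilityMeasure G.tapeLaw := inferInstanceAs (IsProbabilityMeasure (.infinitePi _))
  have hn : (1 : ℝ) ≤ n := by exact_mod_cast Fin.pos v
  calc expectedRunningTime G k γ
      ≤ (n + 1 : ℕ) + 16 * ∫⁻ tape, ∑' r, (rarelyHitting G γ v r).indicator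
          (fun ω => ∑ i ∈ Finset.range (roundSize γ (r + 1)), (workload G (ω i) : ℝ≥0∞)) tape
          ∂G.tapeLaw := by
        refine (lintegral_mono (runningTime_le G hk γ v)).trans_eq ?_
        rw [lintegral_add_left measurable_const, lintegral_const, measure_univ, mul_one,
          lintegral_const_mul' _ _ ENNReal.ofNat_ne_top]
    _ ≤ (n + 1 : ℕ) + 16 * (ENNReal.ofReal ((2 + 32 * Real.exp (3 / 2)) * γ) *
          (n + G.links.card : ℕ)) := by
        gcongr
        exact lintegral_tsum_rarelyHitting_le G hγ hv
    _ = ENNReal.ofReal (n + 1 + 16 * ((2 + 32 * Real.exp (3 / 2)) * γ * (n + G.links.card))) := by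
        rw [ENNReal.ofReal_add (by positivity) (by positivity),
          ENNReal.ofReal_mul (p := 16) (by positivity),
          ENNReal.ofReal_mul (p := (2 + 32 * Real.exp (3 / 2)) * γ) (by positivity)]
        norm_cast
    _ ≤ _ := by
        refine ENNReal.ofReal_le_ofReal ?_
        have hle : (n : ℝ) + G.links.card ≤ γ * (n + G.links.card) :=
          le_mul_of_one_le_left (by positivity) hγ
        linarith

end RunningTime

lemma one_le_threshold (n k : ℕ) (ε : ℝ) {δ : ℝ} (hδ : 0 < δ) (hδ1 : δ < 1) :
    1 ≤ threshold n k ε δ := by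
  have hlog : Real.log 2 ≤ Real.log (2 / δ) :=
    Real.log_le_log two_pos ((le_div_iff₀ hδ).2 (by linarith))
  have hφ := sq_nonneg (phi n k ε δ)
  rw [threshold]
  linarith [Real.log_two_gt_d9]

end TargetedIM

theorem theorem2_general (a : ℝ) :
    ∃ C : ℝ, ∀ (n : ℕ) (G : TargetedIM.SocialNetwork n) (k : ℕ) (γ : ℝ),
      1 ≤ k → 1 ≤ γ → (n : ℝ) ≤ a * (G.links.card : ℝ) →
        Measurable (TargetedIM.runningTime G k γ) ∧
        TargetedIM.expectedRunningTime G k γ ≤ ENNReal.ofReal (C * (γ * (G.links.card : ℝ))) := by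
  refine ⟨(34 + 512 * Real.exp (3 / 2)) * (a + 1), fun n G k γ hk hγ hn =>
    ⟨TargetedIM.measurable_runningTime G k γ, (TargetedIM.expectedRunningTime_le G hk hγ).trans ?_⟩⟩
  refine ENNReal.ofReal_le_ofReal ?_
  calc (34 + 512 * Real.exp (3 / 2)) * (γ * (n + G.links.card))
      ≤ (34 + 512 * Real.exp (3 / 2)) * (γ * (a * G.links.card + G.links.card)) := by gcongr
    _ = (34 + 512 * Real.exp (3 / 2)) * (a + 1) * (γ * G.links.card) := by ring

theorem theorem2 (a : ℝ) :
    ∃ C : ℝ, ∀ (n : ℕ) (G : TargetedIM.SocialNetwork n) (k : ℕ) (ε δ : ℝ),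
      1 ≤ k → k ≤ n → 0 < ε → 0 < δ → δ < 1 → (n : ℝ) ≤ a * (G.links.card : ℝ) →
        Measurable (TargetedIM.runningTime G k (TargetedIM.threshold n k ε δ)) ∧
        TargetedIM.expectedRunningTime G k (TargetedIM.threshold n k ε δ) ≤
          ENNReal.ofReal (C * (TargetedIM.threshold n k ε δ * (G.links.card : ℝ))) :=
  (theorem2_general a).imp fun _ hC n G k ε _ hk _ _ hδ hδ1 hn =>
    hC n G k _ hk (TargetedIM.one_le_threshold n k ε hδ hδ1) hn
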